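/- Let $K$ be an algebraically closed field of characteristic zero and let $R=K[x_{1,0},x_{1,1},x_{2,0},x_{2,1},x_{3,0},x_{3,1}]$, trigraded by $\deg x_{i,j}=\mathbf e_i\in\mathbb Z^3$, be the coordinate ring of $\mathbb P^1\times\mathbb P^1\times\mathbb P^1$ over $K$. For $S\subseteq\mathbb P^1\times\mathbb P^1\times\mathbb P^1$ let $I_S\subseteq R$ be the ideal generated by the trihomogeneous polynomials vanishing on $S$. A line of $\mathbb P^1\times\mathbb P^1\times\mathbb P^1$ is the zero locus of two nonzero linear forms $F,G\in R$ of degrees $\mathbf e_i$ and $\mathbf e_j$ with $i\ne j$. Let $\mathcal C\subseteq\mathbb P^1\times\mathbb P^1\times\mathbb P^1$ be a finite set of points that is a complete intersection of type $(a,b,c)$, i.e. $I_{\mathcal C}=(F_1,F_2,F_3)$ for a regular sequence $F_1,F_2,F_3$ of trihomogeneous polynomials of degrees $(a,0,0)$, $(0,b,0)$, $(0,0,c)$ respectively. Let $X_{\mathcal C}$ be the grid of lines arising from $\mathcal C$, i.e. the union of all lines of $\mathbb P^1\times\mathbb P^1\times\mathbb P^1$ that pass through some point of $\mathcal C$. Then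 $X_{\mathcal C}$ is arithmetically Cohen--Macaulay, that is, $\operatorname{depth}(R/I_{X_{\mathcal C}})=\dim(R/I_{X_{\mathcal C}})$, where depth is taken with respect to the homogeneous maximal ideal $(x_{1,0},\dots,x_{3,1})$ and $\dim$ is the Krull dimension. Moreover, $I_{X_{\mathcal C}}$ has a trigraded minimal free resolution of the form $$0\to R(-a,-b,-c)^2\to R(-a,-b,0)\oplus R(-a,0,-c)\oplus R(0,-b,-c)\to I_{X_{\mathcal C}}\to 0.$$ -/

import Mathlib

open scoped LinearAlgebra.Projectivization

noncomputable section

namespace TriProj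

/-- The polynomial ring `R = K[x_{i,j}]`, with `i` ranging over the three factors and
`j` over the two homogeneous coordinates of each factor. -/
abbrev R (K : Type*) [Field K] := MvPolynomial (Fin 3 × Fin 2) K

/-- The trigrading `deg x_{i,j} = e_i`. The grading group is `ℤ³`, so that twists make sense;
the pieces of a degree with a negative coordinate are zero. -/
def weight (p : Fin 3 × Fin 2) : Fin 3 → ℤ := Pi.single p.1 1

/-- `f` lies in the graded piece `R_d`. -/
def IsTrihomogeneous {K : Type*} [Field K] (f : R K) (d : Fin 3 → ℤ) : Prop :=
  MvPolynomial.IsWeightedHomogeneous weight f d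

/-- The homogeneous maximal ideal, generated by all the variables. -/
def irrelevantIdeal (K : Type*) [Field K] : Ideal (R K) :=
  Ideal.span (Set.range MvPolynomial.X)

/-! ### Points and subvarieties of `ℙ¹ × ℙ¹ × ℙ¹` -/

/-- A point of `ℙ¹ × ℙ¹ × ℙ¹`. -/
abbrev Point (K : Type*) [Field K] := Fin 3 → ℙ K (Fin 2 → K)

/-- `v` is a system of homogeneous coordinates of the point `P`. -/
def IsRepresentative {K : Type*} [Field K] (v : Fin 3 → Fin 2 → K) (P : Point K) : Prop :=
  ∀ i, ∃ h : v i ≠ 0, Projectivization.mk K (v i) h = P i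

/-- `f` vanishes at `P`, i.e. at every system of homogeneous coordinates of `P`. For
trihomogeneous `f` one system suffices; for general `f` over an infinite field this says that
every trihomogeneous component of `f` vanishes at `P`. -/
def VanishesAt {K : Type*} [Field K] (f : R K) (P : Point K) : Prop :=
  ∀ v, IsRepresentative v P → MvPolynomial.eval (fun p => v p.1 p.2) f = 0

/-- The subset of `ℙ¹ × ℙ¹ × ℙ¹` defined by a set of polynomials. -/
def zeroLocus {K : Type*} [Field K] (T : Set (R K)) : Set (Point K) :=
  {P | ∀ f ∈ T, VanishesAt f P}

/-- The homogeneous ideal `I_S` of a subset `S` of `ℙ¹ × ℙ¹ × ℙ¹`. -/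
def vanishingIdeal {K : Type*} [Field K] (S : Set (Point K)) : Ideal (R K) where
  carrier := {f | ∀ P ∈ S, VanishesAt f P}
  zero_mem' := fun P _ v _ => by simp
  add_mem' := fun hf hg P hP v hv => by
    rw [map_add, hf P hP v hv, hg P hP v hv, add_zero]
  smul_mem' := fun r f hf P hP v hv => by
    rw [smul_eq_mul, map_mul, hf P hP v hv, mul_zero]

/-- A line `ℒ(F, G)`: the locus defined by nonzero linear forms `F`, `G` of two different
degrees `e_i`, `e_j`. -/
def IsLine {K : Type*} [Field K] (L : Set (Point K)) : Prop :=
  ∃ (i j : Fin 3) (F G : R K), i ≠ j ∧ F ≠ 0 ∧ G ≠ 0 ∧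
    IsTrihomogeneous F (Pi.single i 1) ∧ IsTrihomogeneous G (Pi.single j 1) ∧
    L = zeroLocus {F, G}

/-- The lines passing through some point of `Y`. -/
def gridOfLines {K : Type*} [Field K] (Y : Set (Point K)) : Set (Set (Point K)) :=
  {L | IsLine L ∧ ∃ P ∈ Y, P ∈ L}

/-- The variety `X_Y`, the union of the lines passing through some point of `Y`. -/
def gridVariety {K : Type*} [Field K] (Y : Set (Point K)) : Set (Point K) :=
  ⋃₀ gridOfLines Y

/-- `C` is a complete intersection of points of type `(a 0, a 1, a 2)`: its ideal is generated
by a regular sequence `F 0, F 1, F 2` with `deg F i = a i • e_i`. -/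
def IsCompleteIntersectionOfPoints {K : Type*} [Field K] (C : Set (Point K))
    (a : Fin 3 → ℕ) : Prop :=
  ∃ F : Fin 3 → R K, (∀ i, IsTrihomogeneous (F i) (Pi.single i (a i : ℤ))) ∧
    RingTheory.Sequence.IsRegular (R K) [F 0, F 1, F 2] ∧
    vanishingIdeal C = Ideal.span {F 0, F 1, F 2}

/-! ### Depth and the arithmetically Cohen-Macaulay property -/

/-- The depth of a module `M` with respect to an ideal `J`: the supremum of the lengths of the
`M`-regular sequences in `J`. -/
def depth {A : Type*} [CommRing A] (J : Ideal A) (M : Type*) [AddCommGroup M] [Module A M] :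
    ℕ∞ :=
  ⨆ (rs : List A) (_ : RingTheory.Sequence.IsRegular M rs ∧ ∀ r ∈ rs, r ∈ J), (rs.length : ℕ∞)

/-- `X` is arithmetically Cohen-Macaulay: `depth (R / I_X) = dim (R / I_X)`, the depth of the
graded ring being taken with respect to the homogeneous maximal ideal. -/
def IsACM {K : Type*} [Field K] (X : Set (Point K)) : Prop :=
  ((depth (irrelevantIdeal K) (R K ⧸ vanishingIdeal X) : ℕ∞) : WithBot ℕ∞) =
    ringKrullDim (R K ⧸ vanishingIdeal X)

/-! ### Trigraded free resolutions -/

/-- `v` lies in the piece of degree `n` of the trigraded free module `⨁ i, R(-d i)`, whose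
underlying module is `ι → R`. -/
def IsHomogeneousVector {K : Type*} [Field K] {ι : Type*} (d : ι → Fin 3 → ℤ) (v : ι → R K)
    (n : Fin 3 → ℤ) : Prop :=
  ∀ i, IsTrihomogeneous (v i) (n - d i)

/-- The maps `φ` and `ε` form a trigraded minimal free resolution
`0 → ⨁ i, R(-d₁ i) → ⨁ k, R(-d₀ k) → I → 0` of the ideal `I`. -/
structure IsMinimalFreeResolution {K : Type*} [Field K] {ι κ : Type*} (I : Ideal (R K))
    (d₁ : ι → Fin 3 → ℤ) (d₀ : κ → Fin 3 → ℤ)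
    (φ : (ι → R K) →ₗ[R K] (κ → R K)) (ε : (κ → R K) →ₗ[R K] I) : Prop where
  /-- `φ` preserves the trigrading. -/
  graded_left : ∀ n v, IsHomogeneousVector d₁ v n → IsHomogeneousVector d₀ (φ v) n
  /-- `ε` preserves the trigrading. -/
  graded_right : ∀ n v, IsHomogeneousVector d₀ v n → IsTrihomogeneous (ε v : R K) n
  injective : Function.Injective φ
  exact : Function.Exact φ ε
  surjective : Function.Surjective ε
  /-- Minimality: the image of `φ` lies in `𝔪 · ⨁ k, R(-d₀ k)`. -/
  minimal : LinearMap.range φ ≤ irrelevantIdeal K • (⊤ : Submodule (R K) (κ → R K))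

end TriProj

end

/-! Write `F i` for the form of degree `a i • e_i`; it involves only the `i`-th block of two
variables. A line fixes two of the three coordinates and leaves one free, so the grid variety is the
union over `k` of the families of lines through `C` in direction `k`. The ideal of the `k`-th family
is generated by the two forms `F i` with `i ≠ k` (`vanishingIdeal_thickening_eq`). Intersecting
these three ideals gives the ideal of pairwise products `F 0 * F 1`, `F 0 * F 2`, `F 1 * F 2`
(`vanishingIdeal_gridVariety_eq`).

This ideal has codimension at least two, so its quotient has dimension at most `6 - 2 = 4`. Choose
linear forms `l i` in block `i` coprime to `F i`. Coprime pairs in disjoint blocks are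
nonzerodivisors modulo one another in any order (`permutablyRegular_rename`, by flat base change
from a single block). It follows that `l 0, l 1, l 2, F 0 + F 1 + F 2` is a regular sequence on the
quotient, so the depth is at least 4. Since depth never exceeds dimension, the two are equal.

The resolution is of Hilbert–Burch type: the products are, up to sign, the maximal minors of an
explicit 3 × 2 matrix, and exactness reduces to cancelling one form modulo another. -/

namespace TriProj

open RingTheory.Sequence

/-! ### Regular sequences on cyclic modules, depth and dimension -/

section RegularMod

variable {A : Type*} [CommRing A]

/-- The element `u` is a nonzerodivisor modulo the ideal `I`. -/
def RegularMod (I : Ideal A) (u : A) : Prop := ∀ f, u * f ∈ I → f ∈ I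

lemma mk_mem_smul_top_iff (I J : Ideal A) (f : A) :
    (Ideal.Quotient.mk I f) ∈ (J • ⊤ : Submodule A (A ⧸ I)) ↔ f ∈ I ⊔ J := by
  have h : (J • ⊤ : Submodule A (A ⧸ I)) = Submodule.map I.mkQ J := by
    rw [← Submodule.range_mkQ I, ← Submodule.map_top, ← Submodule.map_smul'']
    simp
  rw [h]
  change I.mkQ f ∈ _ ↔ _
  rw [← Submodule.mem_comap, Submodule.comap_map_mkQ]

lemma isSMulRegular_quotient_iff (I J : Ideal A) (u : A) :
    IsSMulRegular ((A ⧸ I) ⧸ (J • ⊤ : Submodule A (A ⧸ I))) u ↔ RegularMod (I ⊔ J) u := by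
  rw [isSMulRegular_iff_right_eq_zero_of_smul]
  have key (f : A) : (Submodule.Quotient.mk (Ideal.Quotient.mk I f) :
      (A ⧸ I) ⧸ (J • ⊤ : Submodule A (A ⧸ I))) = 0 ↔ f ∈ I ⊔ J := by
    rw [Submodule.Quotient.mk_eq_zero, mk_mem_smul_top_iff]
  constructor
  · intro h f hf
    rw [← key] at hf ⊢
    exact h _ hf
  · intro h x hx
    obtain ⟨y, rfl⟩ := Submodule.Quotient.mk_surjective _ x
    obtain ⟨f, rfl⟩ := Ideal.Quotient.mk_surjective y
    rw [key]
    exact h f ((key _).1 hx)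

lemma isWeaklyRegular_quotient_iff (I : Ideal A) (rs : List A) :
    IsWeaklyRegular (A ⧸ I) rs ↔
      ∀ i (hi : i < rs.length), RegularMod (I ⊔ Ideal.ofList (rs.take i)) rs[i] := by
  rw [isWeaklyRegular_iff]
  exact forall₂_congr fun i hi => isSMulRegular_quotient_iff _ _ _

lemma isWeaklyRegular_self_iff (rs : List A) :
    IsWeaklyRegular A rs ↔
      ∀ i (hi : i < rs.length), RegularMod (Ideal.ofList (rs.take i)) rs[i] := by
  rw [← (Submodule.quotEquivOfEqBot (⊥ : Ideal A) rfl).isWeaklyRegular_congr,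
    isWeaklyRegular_quotient_iff]
  simp

lemma ringKrullDim_quotient_sup_span_add_one_le {I : Ideal A} {u : A} (h : RegularMod I u) :
    ringKrullDim (A ⧸ I ⊔ Ideal.span {u}) + 1 ≤ ringKrullDim (A ⧸ I) := by
  have hu : Ideal.Quotient.mk I u ∈ nonZeroDivisors (A ⧸ I) := by
    rw [mem_nonZeroDivisors_iff_right]
    intro x hx
    obtain ⟨f, rfl⟩ := Ideal.Quotient.mk_surjective x
    rw [← map_mul, Ideal.Quotient.eq_zero_iff_mem, mul_comm] at hx
    exact Ideal.Quotient.eq_zero_iff_mem.2 (h f hx)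
  have := ringKrullDim_quotient_succ_le_of_nonZeroDivisor hu
  rwa [← ringKrullDim_eq_of_ringEquiv (DoubleQuot.quotQuotEquivQuotSup I (Ideal.span {u})),
    Ideal.map_span, Set.image_singleton]

/-- Each nonzerodivisor lowers the dimension by at least one. This serves both for depth ≤ dimension
and, with `I = ⊥`, for the codimension of the ideal of pairwise products. -/
lemma ringKrullDim_quotient_add_length_le (I : Ideal A) (rs : List A)
    (h : ∀ i (hi : i < rs.length), RegularMod (I ⊔ Ideal.ofList (rs.take i)) rs[i]) :
    ringKrullDim (A ⧸ I ⊔ Ideal.ofList rs) + rs.length ≤ ringKrullDim (A ⧸ I) := by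
  induction rs generalizing I with
  | nil =>
    rw [ringKrullDim_eq_of_ringEquiv (Ideal.quotEquivOfEq (by simp : I ⊔ Ideal.ofList [] = I))]
    simp
  | cons r rs ih =>
    have h0 : RegularMod I r := by
      have := h 0 (by simp)
      rw [List.take_zero, Ideal.ofList_nil, sup_bot_eq] at this
      exact this
    have h1 := ih (I ⊔ Ideal.span {r}) fun i hi => by
      have := h (i + 1) (by simpa using hi)
      simpa [Ideal.ofList_cons, sup_assoc] using this
    rw [Ideal.ofList_cons, ← sup_assoc]
    push_cast [List.length_cons]
    rw [← add_assoc]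
    exact (add_le_add_left h1 1).trans (ringKrullDim_quotient_sup_span_add_one_le h0)

/-- The depth of a cyclic module never exceeds its dimension. -/
lemma depth_quotient_le_ringKrullDim (J I : Ideal A) (hI : I ≠ ⊤) :
    ((depth J (A ⧸ I) : ℕ∞) : WithBot ℕ∞) ≤ ringKrullDim (A ⧸ I) := by
  have : Nontrivial (A ⧸ I) := Ideal.Quotient.nontrivial_iff.2 hI
  obtain ⟨n, hn⟩ := WithBot.ne_bot_iff_exists.1 fun h : ringKrullDim (A ⧸ I) = ⊥ => by
    simpa [h] using ringKrullDim_nonneg_of_nontrivial (R := A ⧸ I)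
  rw [← hn, WithBot.coe_le_coe]
  refine iSup₂_le fun rs hrs => ?_
  rw [← WithBot.coe_le_coe, hn]
  have h := ringKrullDim_quotient_add_length_le I rs
    ((isWeaklyRegular_quotient_iff I rs).1 hrs.1.toIsWeaklyRegular)
  have hne : I ⊔ Ideal.ofList rs ≠ ⊤ := by
    intro htop
    apply hrs.1.top_ne_smul
    refine (eq_top_iff.2 fun x _ => ?_).symm
    obtain ⟨f, rfl⟩ := Ideal.Quotient.mk_surjective x
    rw [mk_mem_smul_top_iff, htop]
    trivial
  have : Nontrivial (A ⧸ I ⊔ Ideal.ofList rs) := Ideal.Quotient.nontrivial_iff.2 hne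
  refine le_trans ?_ h
  have h0 : (0 : WithBot ℕ∞) ≤ ringKrullDim (A ⧸ I ⊔ Ideal.ofList rs) :=
    ringKrullDim_nonneg_of_nontrivial
  calc ((rs.length : ℕ∞) : WithBot ℕ∞) = 0 + (rs.length : WithBot ℕ∞) := by simp
    _ ≤ _ := by gcongr

/-- A weakly regular sequence inside a proper ideal `J ⊇ I` bounds the depth from below. -/
lemma length_le_depth_quotient {J I : Ideal A} (hIJ : I ≤ J) (hJ : J ≠ ⊤) {rs : List A}
    (hrs : ∀ r ∈ rs, r ∈ J) (h : IsWeaklyRegular (A ⧸ I) rs) :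
    (rs.length : ℕ∞) ≤ depth J (A ⧸ I) := by
  refine le_iSup₂_of_le rs ⟨⟨h, fun htop => hJ ?_⟩, hrs⟩ le_rfl
  have h1 : Ideal.Quotient.mk I 1 ∈ (Ideal.ofList rs • ⊤ : Submodule A (A ⧸ I)) := by
    rw [← htop]; trivial
  rw [mk_mem_smul_top_iff] at h1
  refine (Ideal.eq_top_iff_one _).2 (sup_le hIJ (Ideal.span_le.2 hrs) h1)

end RegularMod

/-! ### The ideal of pairwise products of three elements -/

section PairIdeal

variable {A : Type*} [CommRing A]

/-- The ideal generated by the pairwise products of three elements. -/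
def pairIdeal (F : Fin 3 → A) : Ideal A := Ideal.span {F 0 * F 1, F 0 * F 2, F 1 * F 2}

/-- Write `f = t + c * F 0 + d * F 2`. Membership in `T + (F 0, F 1)` lets `F 2` be cancelled from
`F 2 * d`, which expands `d`; membership in `T + (F 1, F 2)` then lets `F 0` be cancelled and
controls `c`. The extra ideal `T` carries the elements of a regular sequence already divided out. -/
lemma mem_sup_pairIdeal_of_mem {F : Fin 3 → A} {T : Ideal A}
    (h2 : RegularMod (T ⊔ Ideal.span {F 0, F 1}) (F 2))
    (h0 : RegularMod (T ⊔ Ideal.span {F 1, F 2}) (F 0)) {f : A}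
    (h01 : f ∈ T ⊔ Ideal.span {F 0, F 1}) (h02 : f ∈ T ⊔ Ideal.span {F 0, F 2})
    (h12 : f ∈ T ⊔ Ideal.span {F 1, F 2}) : f ∈ T ⊔ pairIdeal F := by
  have mem (I : Ideal A) (x y g : A) :
      g ∈ I ⊔ Ideal.span {x, y} ↔ ∃ t ∈ I, ∃ a b, t + (a * x + b * y) = g := by
    simp only [Submodule.mem_sup, Ideal.mem_span_pair]
    constructor
    · rintro ⟨t, ht, _, ⟨a, b, rfl⟩, rfl⟩; exact ⟨t, ht, a, b, rfl⟩
    · rintro ⟨t, ht, a, b, rfl⟩; exact ⟨t, ht, _, ⟨a, b, rfl⟩, rfl⟩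
  obtain ⟨t, ht, c, d, rfl⟩ := (mem _ _ _ _).1 h02
  have hd : d ∈ T ⊔ Ideal.span {F 0, F 1} := by
    refine h2 d ?_
    have : F 2 * d = (t + (c * F 0 + d * F 2)) - (t + (c * F 0 + 0 * F 1)) := by ring
    rw [this]
    exact sub_mem h01 ((mem _ _ _ _).2 ⟨t, ht, c, 0, rfl⟩)
  obtain ⟨s, hs, p, q, rfl⟩ := (mem _ _ _ _).1 hd
  have hc : c + p * F 2 ∈ T ⊔ Ideal.span {F 1, F 2} := by
    refine h0 _ ?_
    have : F 0 * (c + p * F 2) = (t + (c * F 0 + (s + (p * F 0 + q * F 1)) * F 2)) -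
      (t + (0 * F 1 + (s + q * F 1) * F 2)) := by ring
    rw [this]
    exact sub_mem h12 ((mem _ _ _ _).2 ⟨t, ht, _, _, rfl⟩)
  obtain ⟨r, hr, v, w, hvw⟩ := (mem _ _ _ _).1 hc
  have : t + (c * F 0 + (s + (p * F 0 + q * F 1)) * F 2) =
      (t + F 2 * s + F 0 * r) + (v * (F 0 * F 1) + w * (F 0 * F 2) + q * (F 1 * F 2)) := by
    linear_combination - F 0 * hvw
  rw [this]
  refine Submodule.add_mem_sup
    (add_mem (add_mem ht (T.mul_mem_left _ hs)) (T.mul_mem_left _ hr))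
    (add_mem (add_mem ?_ ?_) ?_) <;>
  exact Ideal.mul_mem_left _ _ (Ideal.subset_span (by simp))

lemma pairIdeal_le (F : Fin 3 → A) : pairIdeal F ≤ Ideal.span {F 0, F 1} ∧
    pairIdeal F ≤ Ideal.span {F 0, F 2} ∧ pairIdeal F ≤ Ideal.span {F 1, F 2} := by
  have h (x y z : A) (hz : z = x ∨ z = y) (r : A) : r * z ∈ Ideal.span {x, y} :=
    Ideal.mul_mem_left _ _ (Ideal.subset_span hz)
  have h' (x y z : A) (hz : z = x ∨ z = y) (r : A) : z * r ∈ Ideal.span {x, y} :=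
    Ideal.mul_mem_right _ _ (Ideal.subset_span hz)
  refine ⟨?_, ?_, ?_⟩ <;> refine Ideal.span_le.2 ?_ <;> rintro _ (rfl | rfl | rfl) <;>
  first
    | exact h _ _ _ (Or.inl rfl) _
    | exact h _ _ _ (Or.inr rfl) _
    | exact h' _ _ _ (Or.inl rfl) _
    | exact h' _ _ _ (Or.inr rfl) _

/-- Since `T ⊔ pairIdeal F` is the intersection of the three ideals `T + (F i, F j)`, regularity may
be tested on each of them. -/
lemma regularMod_sup_pairIdeal {F : Fin 3 → A} {T : Ideal A}
    (h2 : RegularMod (T ⊔ Ideal.span {F 0, F 1}) (F 2))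
    (h0 : RegularMod (T ⊔ Ideal.span {F 1, F 2}) (F 0)) {u : A}
    (h01 : RegularMod (T ⊔ Ideal.span {F 0, F 1}) u)
    (h02 : RegularMod (T ⊔ Ideal.span {F 0, F 2}) u)
    (h12 : RegularMod (T ⊔ Ideal.span {F 1, F 2}) u) : RegularMod (T ⊔ pairIdeal F) u := by
  intro f hf
  obtain ⟨l1, l2, l3⟩ := pairIdeal_le F
  exact mem_sup_pairIdeal_of_mem h2 h0 (h01 f (sup_le_sup_left l1 T hf))
    (h02 f (sup_le_sup_left l2 T hf)) (h12 f (sup_le_sup_left l3 T hf))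

lemma RegularMod.of_sub_mem {I : Ideal A} {u v : A} (h : RegularMod I v) (huv : u - v ∈ I) :
    RegularMod I u := by
  intro f hf
  refine h f ?_
  have : v * f = u * f - (u - v) * f := by ring
  rw [this]
  exact sub_mem hf (I.mul_mem_right _ huv)

/-- A family all of whose members are nonzerodivisors modulo any set of other members. -/
def PermutablyRegular {ι : Type*} (e : ι → A) : Prop :=
  ∀ (S : Set ι) (p : ι), p ∉ S → RegularMod (Ideal.span (e '' S)) (e p)

lemma PermutablyRegular.sup_span_pair {ι : Type*} {e : ι → A} (he : PermutablyRegular e)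
    (S : Set ι) {i j k : ι} (hk : k ∉ S ∪ {i, j}) :
    RegularMod (Ideal.span (e '' S) ⊔ Ideal.span {e i, e j}) (e k) := by
  rw [← Ideal.span_union, ← Set.image_pair, ← Set.image_union]
  exact he _ _ hk

lemma PermutablyRegular.dvd_of_dvd_mul {ι : Type*} {e : ι → A} (he : PermutablyRegular e)
    {i j : ι} (hij : i ≠ j) {f : A} (h : e i ∣ e j * f) : e i ∣ f := by
  have := he {i} j (by simpa using hij.symm) f
  rw [Set.image_singleton, Ideal.mem_span_singleton, Ideal.mem_span_singleton] at this
  exact this h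

lemma PermutablyRegular.eq_zero_of_mul {ι : Type*} {e : ι → A} (he : PermutablyRegular e)
    {i : ι} {f : A} (h : e i * f = 0) : f = 0 := by
  have := he ∅ i (by simp) f
  simpa [h] using this

lemma PermutablyRegular.isWeaklyRegular_quotient_pairIdeal {e : Fin 3 × Fin 2 → A}
    (he : PermutablyRegular e) :
    IsWeaklyRegular (A ⧸ pairIdeal fun i => e (i, 1))
      [e (0, 0), e (1, 0), e (2, 0), e (0, 1) + e (1, 1) + e (2, 1)] := by
  rw [isWeaklyRegular_quotient_iff]
  have main (S : Set (Fin 3 × Fin 2)) (hS : ∀ q ∈ S, q.2 = 0) (u : A)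
      (hu : ∀ i j k : Fin 3, i ≠ j → i ≠ k → j ≠ k →
        RegularMod (Ideal.span (e '' S) ⊔ Ideal.span {e (i, 1), e (j, 1)}) u) :
      RegularMod ((pairIdeal fun i => e (i, 1)) ⊔ Ideal.span (e '' S)) u := by
    rw [sup_comm]
    have hS' (i : Fin 3) : (i, 1) ∉ S := fun h => by simpa using hS _ h
    exact regularMod_sup_pairIdeal (F := fun i => e (i, 1))
      (he.sup_span_pair S (i := (0, 1)) (j := (1, 1)) (k := (2, 1)) (by simp [hS']))
      (he.sup_span_pair S (i := (1, 1)) (j := (2, 1)) (k := (0, 1)) (by simp [hS']))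
      (hu 0 1 2 (by simp) (by simp) (by simp)) (hu 0 2 1 (by simp) (by simp) (by simp))
      (hu 1 2 0 (by simp) (by simp) (by simp))
  intro i hi
  have hi : i < 4 := hi
  interval_cases i
  · have := main ∅ (by simp) (e (0, 0)) fun i j k _ _ _ => he.sup_span_pair _ (by simp)
    simpa using this
  · have := main {(0, 0)} (by simp) (e (1, 0)) fun i j k _ _ _ => he.sup_span_pair _ (by simp)
    simpa [Ideal.ofList] using this
  · have := main {(0, 0), (1, 0)} (by simp) (e (2, 0)) fun i j k _ _ _ =>
      he.sup_span_pair _ (by simp)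
    simpa [Ideal.ofList_cons, Set.image_pair, Ideal.span_insert] using this
  -- Modulo two of the three elements `e (i, 1)`, their sum is congruent to the remaining one, which
  -- is regular. No single `e (k, 1)` would do, as it lies in two of the three ideals.
  · have := main {(0, 0), (1, 0), (2, 0)} (by simp) (e (0, 1) + e (1, 1) + e (2, 1))
      fun i j k hij hik hjk => by
        refine (he.sup_span_pair (k := (k, 1)) _ (by simp [hik.symm, hjk.symm])).of_sub_mem
          (Ideal.mem_sup_right ?_)
        have : e (0, 1) + e (1, 1) + e (2, 1) - e (k, 1) = e (i, 1) + e (j, 1) := by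
          fin_cases i <;> fin_cases j <;> fin_cases k <;> simp at hij hik hjk ⊢ <;> ring
        rw [this]
        exact add_mem (Ideal.subset_span (by simp)) (Ideal.subset_span (by simp))
    simpa [Ideal.ofList_cons, Set.image_insert_eq, Ideal.span_insert] using this

/-- The ideal of pairwise products has codimension at least two. -/
lemma PermutablyRegular.ringKrullDim_quotient_pairIdeal_add_two_le {F : Fin 3 → A}
    (hF : PermutablyRegular F) : ringKrullDim (A ⧸ pairIdeal F) + 2 ≤ ringKrullDim A := by
  have hd {i j : Fin 3} (hij : i ≠ j) {f : A} (h : F i ∣ F j * f) : F i ∣ f :=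
    hF.dvd_of_dvd_mul hij h
  -- A regular sequence of length two inside `pairIdeal F`. Modulo `F 0` the second element is `F 2
  -- * F 1`, modulo `F 1` it is `F 2 * F 0`; hence a multiplier that brings it into `(F 0 * F 1)` is
  -- divisible by both `F 0` and `F 1`, so by their product.
  have h := ringKrullDim_quotient_add_length_le ⊥ [F 0 * F 1, F 2 * (F 0 + F 1)] fun i hi => by
    have hi : i < 2 := hi
    interval_cases i
    · intro f hf
      have hf : F 0 * F 1 * f = 0 := by simpa using hf
      rw [mul_assoc] at hf
      simpa using hF.eq_zero_of_mul (hF.eq_zero_of_mul hf)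
    · intro f hf
      have hf : F 0 * F 1 ∣ F 2 * (F 0 + F 1) * f := by
        simpa [Ideal.ofList, Ideal.mem_span_singleton] using hf
      have h0 : F 0 ∣ f := by
        refine hd (j := 1) (by simp) (hd (j := 2) (by simp) ?_)
        have : F 2 * (F 1 * f) = F 2 * (F 0 + F 1) * f - F 0 * (F 2 * f) := by ring
        rw [this]
        exact dvd_sub ((dvd_mul_right _ _).trans hf) (dvd_mul_right _ _)
      have h1 : F 1 ∣ f := by
        refine hd (j := 0) (by simp) (hd (j := 2) (by simp) ?_)
        have : F 2 * (F 0 * f) = F 2 * (F 0 + F 1) * f - F 1 * (F 2 * f) := by ring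
        rw [this]
        exact dvd_sub ((dvd_mul_left _ _).trans hf) (dvd_mul_right _ _)
      obtain ⟨g, rfl⟩ := h0
      obtain ⟨g', rfl⟩ := hd (by simp) h1
      simp only [List.take_succ_cons, List.take_zero, Ideal.ofList_singleton, bot_sup_eq,
        Ideal.mem_span_singleton]
      exact ⟨g', by ring⟩
  have hle : (⊥ : Ideal A) ⊔ Ideal.ofList [F 0 * F 1, F 2 * (F 0 + F 1)] ≤ pairIdeal F := by
    refine sup_le bot_le (Ideal.span_le.2 fun r hr => ?_)
    have h01 : F 0 * F 1 ∈ pairIdeal F := Ideal.subset_span (by simp)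
    have h02 : F 0 * F 2 ∈ pairIdeal F := Ideal.subset_span (by simp)
    have h12 : F 1 * F 2 ∈ pairIdeal F := Ideal.subset_span (by simp)
    rcases (by simpa using hr : r = F 0 * F 1 ∨ r = F 2 * (F 0 + F 1)) with rfl | rfl
    · exact h01
    · have : F 2 * (F 0 + F 1) = F 0 * F 2 + F 1 * F 2 := by ring
      rw [this]
      exact add_mem h02 h12
  have hs := ringKrullDim_le_of_surjective _ (Ideal.Quotient.factor_surjective hle)
  rw [ringKrullDim_eq_of_ringEquiv (RingEquiv.quotientBot A)] at h
  refine le_trans ?_ h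
  simp only [List.length_cons, List.length_nil]
  gcongr
  simp

end PairIdeal

/-! ### Polynomials in disjoint blocks of variables -/

section Independence

open MvPolynomial

variable {K : Type*} [Field K]

-- Every `K`-algebra `D` is flat over the field `K`, so `D[τ]` is flat over `K[τ]`, and flat
-- extension preserves weakly regular sequences. `D` may have zero divisors: it will be a quotient
-- by relations in the other blocks.
attribute [local instance] MvPolynomial.algebraMvPolynomial in
lemma regularMod_map_of_isWeaklyRegular {τ D : Type*} [CommRing D] [Algebra K D]
    {rs : List (MvPolynomial τ K)} {u : MvPolynomial τ K}
    (h : IsWeaklyRegular (MvPolynomial τ K) (rs ++ [u])) :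
    RegularMod (Ideal.ofList (rs.map (map (algebraMap K D)))) (map (algebraMap K D) u) := by
  have : Module.Flat (MvPolynomial τ K) (MvPolynomial τ D) :=
    Module.Flat.isBaseChange K (MvPolynomial τ K) D (MvPolynomial τ D)
      (Algebra.IsPushout.out (R := K) (S := MvPolynomial τ K) (R' := D) (S' := MvPolynomial τ D))
  have h' := (isWeaklyRegular_self_iff _).1 (h.of_flat (S := MvPolynomial τ D)) rs.length (by simp)
  simp only [MvPolynomial.algebraMap_def, List.map_append, List.map_cons, List.map_nil] at h'
  simpa [-MvPolynomial.algebraMap_def, List.take_append_of_le_length] using h'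

/-- A polynomial in the `k`-th block of variables stays regular after adding to a sequence in that
block arbitrary relations in the other variables. -/
lemma regularMod_rename_sup_span {ι τ : Type*} [DecidableEq ι] (k : ι)
    {rs : List (MvPolynomial τ K)} {u : MvPolynomial τ K}
    (h : IsWeaklyRegular (MvPolynomial τ K) (rs ++ [u])) (B : Set (MvPolynomial (ι × τ) K))
    (hB : ∀ b ∈ B, ∃ i ≠ k, ∃ g : MvPolynomial τ K, rename (Prod.mk i) g = b) :
    RegularMod (Ideal.ofList (rs.map (rename (Prod.mk k))) ⊔ Ideal.span B)
      (rename (Prod.mk k) u) := by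
  -- `ψ` separates the `k`-th block from the others, which become coefficients, and `χ` substitutes
  -- back. The coefficient ring is kept as the full ring, so `ψ` is only a section of `χ`, which
  -- suffices.
  let ψ : MvPolynomial (ι × τ) K →ₐ[K] MvPolynomial τ (MvPolynomial (ι × τ) K) :=
    aeval fun p => if p.1 = k then X p.2 else C (X p)
  let χ : MvPolynomial τ (MvPolynomial (ι × τ) K) →ₐ[MvPolynomial (ι × τ) K]
      MvPolynomial (ι × τ) K := aeval fun j => X (k, j)
  have hχψ (f : MvPolynomial (ι × τ) K) : χ (ψ f) = f := by
    have : ((χ.restrictScalars K).comp ψ) = AlgHom.id K (MvPolynomial (ι × τ) K) := by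
      ext p
      obtain ⟨i, j⟩ := p
      by_cases hi : i = k <;> simp [χ, ψ, hi]
    exact DFunLike.congr_fun this f
  have hψk (g : MvPolynomial τ K) :
      ψ (rename (Prod.mk k) g) = map (algebraMap K (MvPolynomial (ι × τ) K)) g := by
    have : ψ.comp (rename (Prod.mk k)) =
        mapAlgHom (Algebra.ofId K (MvPolynomial (ι × τ) K)) := by
      ext j
      simp [ψ]
    exact DFunLike.congr_fun this g
  have hψC (b) (hb : b ∈ B) : ψ b = C b := by
    obtain ⟨i, hi, g, rfl⟩ := hB b hb
    have : ψ.comp (rename (Prod.mk i)) =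
        ((Algebra.ofId (MvPolynomial (ι × τ) K) (MvPolynomial τ (MvPolynomial (ι × τ) K))).restrictScalars K).comp
          (rename (Prod.mk i)) := by
      ext j
      simp [ψ, hi, Algebra.ofId_apply]
    exact DFunLike.congr_fun this g
  have hχk (g : MvPolynomial τ K) :
      χ (map (algebraMap K (MvPolynomial (ι × τ) K)) g) = rename (Prod.mk k) g := by
    rw [← hψk, hχψ]
  let q := Ideal.Quotient.mk (Ideal.span B)
  let D := (MvPolynomial (ι × τ) K) ⧸ Ideal.span B
  have hq (g : MvPolynomial τ K) :
      map q (map (algebraMap K (MvPolynomial (ι × τ) K)) g) = map (algebraMap K D) g := by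
    rw [map_map]
    rfl
  intro f hf
  have hΨ : map q (ψ f) ∈ Ideal.ofList (rs.map (map (algebraMap K D))) := by
    apply regularMod_map_of_isWeaklyRegular h
    rw [← hq, ← hψk, ← map_mul, ← map_mul]
    have hle : Ideal.ofList (rs.map (rename (Prod.mk k))) ⊔ Ideal.span B ≤
        Ideal.comap ((map q).comp ψ.toRingHom) (Ideal.ofList (rs.map (map (algebraMap K D)))) := by
      refine sup_le (Ideal.span_le.2 ?_) (Ideal.span_le.2 ?_)
      · rintro _ hr
        obtain ⟨r, hrs, rfl⟩ := List.mem_map.1 hr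
        rw [SetLike.mem_coe, Ideal.mem_comap]
        change map q (ψ _) ∈ _
        rw [hψk, hq]
        exact Ideal.subset_span (List.mem_map_of_mem hrs)
      · intro b hb
        rw [SetLike.mem_coe, Ideal.mem_comap]
        change map q (ψ _) ∈ _
        rw [hψC b hb, map_C, Ideal.Quotient.eq_zero_iff_mem.2 (Ideal.subset_span hb), C_0]
        exact zero_mem _
    exact hle hf
  have hmap : Ideal.ofList (rs.map (map (algebraMap K D))) =
      Ideal.map (map q) (Ideal.ofList (rs.map (map (algebraMap K (MvPolynomial (ι × τ) K))))) := by
    rw [Ideal.map_ofList, List.map_map]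
    congr 2
    funext g
    exact (hq g).symm
  -- Membership over `D` is lifted to the polynomial ring at the cost of the kernel of `map q`, the
  -- extension of `Ideal.span B`; then `χ` returns it to the original ring.
  rw [hmap, ← Ideal.mem_comap, Ideal.comap_map_of_surjective' (map q)
    (map_surjective _ Ideal.Quotient.mk_surjective), ker_map, Ideal.mk_ker] at hΨ
  rw [← hχψ f]
  have hle : Ideal.ofList (rs.map (map (algebraMap K (MvPolynomial (ι × τ) K)))) ⊔
      Ideal.map C (Ideal.span B) ≤
      Ideal.comap χ (Ideal.ofList (rs.map (rename (Prod.mk k))) ⊔ Ideal.span B) := by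
    refine sup_le (Ideal.span_le.2 ?_) (Ideal.map_le_iff_le_comap.2 fun b hb => ?_)
    · rintro _ hr
      obtain ⟨r, hrs, rfl⟩ := List.mem_map.1 hr
      rw [SetLike.mem_coe, Ideal.mem_comap, hχk]
      exact Ideal.mem_sup_left (Ideal.subset_span (List.mem_map_of_mem hrs))
    · rw [Ideal.mem_comap, Ideal.mem_comap]
      have : χ (C b) = b := by simp [χ]
      rw [this]
      exact Ideal.mem_sup_right hb
  exact hle hΨ

/-- Coprime pairs of polynomials in disjoint blocks of variables form a permutably regular
family. -/
lemma permutablyRegular_rename {ι τ : Type*} [DecidableEq ι] (e : ι → Fin 2 → MvPolynomial τ K)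
    (h0 : ∀ i j, e i j ≠ 0) (hrel : ∀ i, IsRelPrime (e i 0) (e i 1)) :
    PermutablyRegular fun p : ι × Fin 2 => rename (Prod.mk p.1) (e p.1 p.2) := by
  rintro S ⟨k, j⟩ hp
  set e' : ι × Fin 2 → MvPolynomial (ι × τ) K := fun p => rename (Prod.mk p.1) (e p.1 p.2)
  have hj {j' : Fin 2} (hj' : j' ≠ j) : IsRelPrime (e k j') (e k j) := by
    fin_cases j <;> fin_cases j' <;> simp at hj' ⊢
    · exact (hrel k).symm
    · exact hrel k
  have hB : ∀ b ∈ e' '' {q ∈ S | q.1 ≠ k},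
      ∃ i ≠ k, ∃ g : MvPolynomial τ K, rename (Prod.mk i) g = b := by
    rintro _ ⟨q, hq, rfl⟩
    exact ⟨q.1, hq.2, _, rfl⟩
  -- As `(k, j) ∉ S` and a block has two members, `S` contains at most the partner of `(k, j)`,
  -- which is coprime to it.
  by_cases hS : ∃ j', (k, j') ∈ S
  · obtain ⟨j', hj'S⟩ := hS
    have hj' : j' ≠ j := fun h => hp (h ▸ hj'S)
    have hw : IsWeaklyRegular (MvPolynomial τ K) ([e k j'] ++ [e k j]) := by
      rw [isWeaklyRegular_self_iff]
      intro i hi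
      have hi : i < 2 := hi
      interval_cases i
      · intro f hf
        simpa [h0] using hf
      · intro f hf
        simp only [List.cons_append, List.nil_append, List.take_succ_cons, List.take_zero,
          Ideal.ofList_singleton, Ideal.mem_span_singleton] at hf ⊢
        exact (hj hj').dvd_of_dvd_mul_left hf
    have := regularMod_rename_sup_span k hw _ hB
    have hI : Ideal.span (e' '' S) = Ideal.ofList ([e k j'].map (rename (Prod.mk k))) ⊔
        Ideal.span (e' '' {q ∈ S | q.1 ≠ k}) := by
      rw [List.map_singleton, Ideal.ofList_singleton, ← Ideal.span_union]
      change _ = Ideal.span ({e' (k, j')} ∪ _)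
      rw [← Set.image_singleton, ← Set.image_union]
      congr 2
      ext ⟨i, j''⟩
      by_cases hi : i = k
      · subst hi
        have : j'' = j ∨ j'' = j' := by
          revert hj'; clear * -; revert j j' j''; decide
        rcases this with rfl | rfl
        · simp [hp, hj'.symm]
        · simp [hj'S]
      · simp [hi]
    rw [hI]
    exact this
  · have hw : IsWeaklyRegular (MvPolynomial τ K) ([] ++ [e k j]) := by
      rw [isWeaklyRegular_self_iff]
      intro i hi
      have hi : i < 1 := hi
      interval_cases i
      intro f hf
      simpa [h0] using hf
    have := regularMod_rename_sup_span k hw _ hB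
    have hI : S = {q ∈ S | q.1 ≠ k} := by
      ext ⟨i, j''⟩
      simp only [Set.mem_ofPred_eq, iff_self_and]
      rintro h rfl
      exact hS ⟨_, h⟩
    rw [hI]
    simpa using this

end Independence

/-! ### Lines, and the ideals of unions of parallel lines -/

section Geometry

open MvPolynomial

variable {K : Type*} [Field K]

lemma weight_apply_eq (d : Fin 3 × Fin 2 →₀ ℕ) (i : Fin 3) :
    Finsupp.weight weight d i = d (i, 0) + d (i, 1) := by
  rw [Finsupp.weight_apply, Finsupp.sum_fintype _ _ (by simp), Fintype.sum_prod_type,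
    Finset.sum_apply, Finset.sum_eq_single i]
  · simp [weight]
  · intro j _ hj
    simp [weight, Pi.single_eq_of_ne hj.symm]
  · simp

lemma IsTrihomogeneous.apply_eq_zero {F : R K} {i : Fin 3} {m : ℤ}
    (hF : IsTrihomogeneous F (Pi.single i m)) {d : Fin 3 × Fin 2 →₀ ℕ} (hd : coeff d F ≠ 0)
    {p : Fin 3 × Fin 2} (hp : p.1 ≠ i) : d p = 0 := by
  have h := congrFun (hF hd) p.1
  rw [weight_apply_eq, Pi.single_eq_of_ne hp] at h
  obtain ⟨i', j⟩ := p
  fin_cases j <;> simp at h ⊢ <;> omega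

lemma IsTrihomogeneous.exists_rename_eq {F : R K} {i : Fin 3} {m : ℤ}
    (hF : IsTrihomogeneous F (Pi.single i m)) :
    ∃ g : MvPolynomial (Fin 2) K, rename (Prod.mk i) g = F := by
  refine exists_rename_eq_of_vars_subset_range F _ (Prod.mk_right_injective i) fun p hp => ?_
  obtain ⟨d, hd, hpd⟩ := (mem_vars_iff_mem_support p).1 hp
  refine ⟨p.2, Prod.ext ?_ rfl⟩
  by_contra hne
  exact Finsupp.mem_support_iff.1 hpd (hF.apply_eq_zero (mem_support_iff.1 hd) (Ne.symm hne))

lemma IsTrihomogeneous.exists_linear {F : R K} {i : Fin 3}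
    (hF : IsTrihomogeneous F (Pi.single i 1)) :
    ∃ α β : K, F = C α * X (i, 0) + C β * X (i, 1) := by
  refine ⟨coeff (Finsupp.single (i, 0) 1) F, coeff (Finsupp.single (i, 1) 1) F, ?_⟩
  ext d
  simp only [coeff_add, coeff_C_mul, coeff_X]
  by_cases hd : coeff d F = 0
  · by_cases h0 : Finsupp.single (i, 0) 1 = d
    · subst h0
      simp [hd, Finsupp.single_left_inj]
    · by_cases h1 : Finsupp.single (i, 1) 1 = d
      · subst h1
        simp [hd, h0]
      · simp [h0, h1, hd]
  · have hz {p : Fin 3 × Fin 2} (hp : p.1 ≠ i) : d p = 0 := hF.apply_eq_zero hd hp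
    have h := congrFun (hF hd) i
    rw [weight_apply_eq, Pi.single_eq_same] at h
    have hcases : (d (i, 0) = 1 ∧ d (i, 1) = 0) ∨ (d (i, 0) = 0 ∧ d (i, 1) = 1) := by omega
    rcases hcases with ⟨h0, h1⟩ | ⟨h0, h1⟩
    · have : d = Finsupp.single (i, 0) 1 := by
        ext ⟨i', j⟩
        by_cases hi : i' = i
        · subst hi
          fin_cases j <;> simp [h0, h1]
        · rw [hz hi, Finsupp.single_eq_of_ne (by simp [hi])]
      subst this
      simp [Finsupp.single_left_inj]
    · have : d = Finsupp.single (i, 1) 1 := by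
        ext ⟨i', j⟩
        by_cases hi : i' = i
        · subst hi
          fin_cases j <;> simp [h0, h1]
        · rw [hz hi, Finsupp.single_eq_of_ne (by simp [hi])]
      subst this
      simp [Finsupp.single_left_inj]

lemma exists_isRepresentative (P : Point K) : ∃ v, IsRepresentative v P :=
  ⟨fun i => (P i).rep, fun i => ⟨(P i).rep_nonzero, (P i).mk_rep⟩⟩

lemma IsRepresentative.update {v : Fin 3 → Fin 2 → K} {P : Point K} (hv : IsRepresentative v P)
    (k : Fin 3) {w : Fin 2 → K} (hw : w ≠ 0) :
    IsRepresentative (Function.update v k w) (Function.update P k (Projectivization.mk K w hw)) := by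
  intro i
  by_cases hi : i = k
  · subst hi
    exact ⟨by simpa using hw, by simp⟩
  · simpa [hi] using hv i

lemma eval_rename_block (v : Fin 3 → Fin 2 → K) (i : Fin 3) (g : MvPolynomial (Fin 2) K) :
    eval (fun p : Fin 3 × Fin 2 => v p.1 p.2) (rename (Prod.mk i) g) = eval (v i) g := by
  rw [eval_rename]
  rfl

lemma vanishesAt_rename_of_eq {i : Fin 3} {g : MvPolynomial (Fin 2) K} {P Q : Point K}
    (hPQ : Q i = P i) (h : VanishesAt (rename (Prod.mk i) g) P) :
    VanishesAt (rename (Prod.mk i) g) Q := by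
  intro v hv
  obtain ⟨u, hu⟩ := exists_isRepresentative P
  rw [eval_rename_block]
  have := h (Function.update u i (v i)) fun i' => by
    by_cases hi : i' = i
    · subst hi
      simpa [hPQ] using hv i'
    · simpa [hi] using hu i'
  rwa [eval_rename_block, Function.update_self] at this

/-- Two points of the projective line killed by the same nonzero linear form agree. -/
lemma eq_of_linear_vanishes {α β : K} (h : α ≠ 0 ∨ β ≠ 0) {p q : Fin 2 → K} (hp : p ≠ 0)
    (hq : q ≠ 0) (h1 : α * p 0 + β * p 1 = 0) (h2 : α * q 0 + β * q 1 = 0) :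
    Projectivization.mk K p hp = Projectivization.mk K q hq := by
  have hdet : p 0 * q 1 = p 1 * q 0 := by
    rcases h with h | h
    · refine mul_left_cancel₀ h ?_
      linear_combination q 1 * h1 - p 1 * h2
    · refine mul_left_cancel₀ h ?_
      linear_combination p 0 * h2 - q 0 * h1
  rw [Projectivization.mk_eq_mk_iff']
  by_cases hq0 : q 0 = 0
  · have hq1 : q 1 ≠ 0 := fun hq1 => hq (by ext j; fin_cases j <;> simp [hq0, hq1])
    refine ⟨p 1 / q 1, ?_⟩
    have : p 0 = 0 := by simpa [hq0, hq1] using hdet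
    ext j
    fin_cases j <;> simp [this, hq0, hq1]
  · refine ⟨p 0 / q 0, ?_⟩
    ext j
    fin_cases j
    · simp [hq0]
    · simp only [Fin.mk_one, Pi.smul_apply, smul_eq_mul]
      field_simp
      rw [hdet, mul_comm]

/-- The points agreeing with a point of `Y` away from the `k`-th factor. -/
def thickening (Y : Set (Point K)) (k : Fin 3) : Set (Point K) :=
  {Q | ∃ P ∈ Y, ∀ i, i ≠ k → Q i = P i}

lemma subset_thickening (Y : Set (Point K)) (k : Fin 3) : Y ⊆ thickening Y k :=
  fun P hP => ⟨P, hP, fun _ _ => rfl⟩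

lemma eq_of_vanishesAt_linear {F : R K} {i : Fin 3} (hF0 : F ≠ 0)
    (hF : IsTrihomogeneous F (Pi.single i 1)) {P Q : Point K} (hP : VanishesAt F P)
    (hQ : VanishesAt F Q) : Q i = P i := by
  obtain ⟨α, β, rfl⟩ := hF.exists_linear
  obtain ⟨p, hp⟩ := exists_isRepresentative P
  obtain ⟨q, hq⟩ := exists_isRepresentative Q
  obtain ⟨hpi, hpP⟩ := hp i
  obtain ⟨hqi, hqQ⟩ := hq i
  rw [← hpP, ← hqQ]
  refine eq_of_linear_vanishes (α := α) (β := β) ?_ hqi hpi (by simpa using hQ q hq)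
    (by simpa using hP p hp)
  by_contra! hc
  simp [hc.1, hc.2] at hF0

lemma exists_linear_vanishesAt (P : Point K) (i : Fin 3) :
    ∃ F : R K, F ≠ 0 ∧ IsTrihomogeneous F (Pi.single i 1) ∧
      ∀ Q : Point K, Q i = P i → VanishesAt F Q := by
  obtain ⟨p, hp⟩ := exists_isRepresentative P
  obtain ⟨hpi, hpP⟩ := hp i
  refine ⟨C (p i 1) * X (i, 0) - C (p i 0) * X (i, 1), fun h => hpi ?_, ?_, fun Q hQ q hq => ?_⟩
  · have h0 := congrArg (coeff (Finsupp.single (i, 0) 1)) h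
    have h1 := congrArg (coeff (Finsupp.single (i, 1) 1)) h
    simp [coeff_C_mul, coeff_X, Finsupp.single_left_inj] at h0 h1
    ext j
    fin_cases j <;> simp [h0, h1]
  · have hX (j : Fin 2) : IsWeightedHomogeneous weight (X (i, j) : R K) (Pi.single i 1) :=
      isWeightedHomogeneous_X K weight (i, j)
    exact ((hX 0).C_mul _).sub ((hX 1).C_mul _)
  · obtain ⟨hqi, hqQ⟩ := hq i
    rw [← hpP, ← hqQ, Projectivization.mk_eq_mk_iff'] at hQ
    obtain ⟨t, ht⟩ := hQ
    simp only [map_sub, map_mul, eval_C, eval_X, ← ht, Pi.smul_apply, smul_eq_mul]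
    ring

lemma mem_zeroLocus_pair {F G : R K} {P : Point K} :
    P ∈ zeroLocus {F, G} ↔ VanishesAt F P ∧ VanishesAt G P := by
  simp [zeroLocus]

/-- A nonzero linear form of degree `e_i` vanishes at exactly one value of the `i`-th coordinate, so
a line through `P` consists of the points agreeing with `P` in two coordinates. -/
lemma gridVariety_eq_iUnion_thickening (Y : Set (Point K)) :
    gridVariety Y = ⋃ k, thickening Y k := by
  ext Q
  rw [gridVariety, Set.mem_sUnion, Set.mem_iUnion]
  constructor
  · rintro ⟨L, ⟨⟨i, j, F, G, hij, hF0, hG0, hF, hG, rfl⟩, P, hP, hPL⟩, hQ⟩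
    rw [mem_zeroLocus_pair] at hPL hQ
    have hi := eq_of_vanishesAt_linear hF0 hF hPL.1 hQ.1
    have hj := eq_of_vanishesAt_linear hG0 hG hPL.2 hQ.2
    obtain ⟨k, hk⟩ : ∃ k : Fin 3, ∀ m, m ≠ k → m = i ∨ m = j := by
      revert hij; clear * -; revert i j; decide
    refine ⟨k, P, hP, fun m hm => ?_⟩
    rcases hk m hm with rfl | rfl
    · exact hi
    · exact hj
  · rintro ⟨k, P, hP, hPQ⟩
    obtain ⟨i, j, hij, hik, hjk⟩ : ∃ i j : Fin 3, i ≠ j ∧ i ≠ k ∧ j ≠ k := by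
      clear * -; revert k; decide
    obtain ⟨F, hF0, hF, hFv⟩ := exists_linear_vanishesAt P i
    obtain ⟨G, hG0, hG, hGv⟩ := exists_linear_vanishesAt P j
    exact ⟨zeroLocus {F, G}, ⟨⟨i, j, F, G, hij, hF0, hG0, hF, hG, rfl⟩, P, hP,
      mem_zeroLocus_pair.2 ⟨hFv P rfl, hGv P rfl⟩⟩,
      mem_zeroLocus_pair.2 ⟨hFv Q (hPQ i hik), hGv Q (hPQ j hjk)⟩⟩

lemma mem_vanishingIdeal {S : Set (Point K)} {f : R K} :
    f ∈ vanishingIdeal S ↔ ∀ P ∈ S, VanishesAt f P := Iff.rfl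

lemma mem_vanishingIdeal_gridVariety {Y : Set (Point K)} {f : R K} :
    f ∈ vanishingIdeal (gridVariety Y) ↔ ∀ k, f ∈ vanishingIdeal (thickening Y k) := by
  simp only [mem_vanishingIdeal, gridVariety_eq_iUnion_thickening, Set.mem_iUnion]
  exact ⟨fun h k P hP => h P ⟨k, hP⟩, fun h P ⟨k, hP⟩ => h k P hP⟩

/-- A polynomial in the `k`-th block of variables is a nonzerodivisor modulo the ideal of a
union of lines in the direction of the `k`-th factor. -/
lemma regularMod_vanishingIdeal_thickening [Infinite K] (Y : Set (Point K)) (k : Fin 3)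
    {u : MvPolynomial (Fin 2) K} (hu : u ≠ 0) :
    RegularMod (vanishingIdeal (thickening Y k)) (rename (Prod.mk k) u) := by
  rintro g hg Q ⟨P, hP, hPQ⟩ v hv
  -- Restriction to the line through `Q` in direction `k`: the `k`-th block stays free, the others
  -- are evaluated at `v`.
  let ρ : R K →ₐ[K] MvPolynomial (Fin 2) K :=
    aeval fun p => if p.1 = k then X p.2 else C (v p.1 p.2)
  have hρ (w : Fin 2 → K) (f : R K) :
      eval w (ρ f) = eval (fun p => Function.update v k w p.1 p.2) f := by
    have : (aeval w).comp ρ = aeval fun p => Function.update v k w p.1 p.2 := by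
      ext ⟨i, j⟩
      by_cases hi : i = k
      · subst hi
        simp [ρ]
      · simp [ρ, hi]
    simpa [aeval_eq_eval] using DFunLike.congr_fun this f
  have hρu : ρ (rename (Prod.mk k) u) = u := by
    have : ρ.comp (rename (Prod.mk k)) = AlgHom.id K _ := by
      ext j
      simp [ρ]
    exact DFunLike.congr_fun this u
  -- The vector `w = 0` represents no point, so nothing is known there; the factor `X 0` makes the
  -- product vanish at it too.
  have hzero : ρ (rename (Prod.mk k) u * g) * X 0 = 0 := by
    refine funext fun w => ?_
    by_cases hw : w = 0
    · simp [hw]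
    · have := hg (Function.update Q k (Projectivization.mk K w hw))
        ⟨P, hP, fun i hi => by simpa [hi] using hPQ i hi⟩ _ (hv.update k hw)
      rw [map_mul, hρ, this]
      simp
  rw [map_mul, hρu] at hzero
  have hρg : ρ g = 0 := by simpa [hu] using hzero
  have := hρ (v k) g
  rw [hρg, Function.update_eq_self] at this
  simpa using this.symm

/-- An ideal generated in the variables outside the `k`-th block is closed in the adic topology
of a form without constant term in the `k`-th block. -/
lemma mem_span_of_forall_mem_sup_pow (k : Fin 3) {u : MvPolynomial (Fin 2) K}
    (hu : constantCoeff u = 0) {B : Set (R K)}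
    (hB : ∀ b ∈ B, ∃ i ≠ k, ∃ g : MvPolynomial (Fin 2) K, rename (Prod.mk i) g = b) {f : R K}
    (hf : ∀ n : ℕ, f ∈ Ideal.span B ⊔ Ideal.span {rename (Prod.mk k) u ^ n}) :
    f ∈ Ideal.span B := by
  -- `θ` scales the `k`-th block by a new variable `t`. It sends `B` to constants and `u` to a
  -- multiple of `t`, so the hypothesis for exponent `m + 1` puts the `t ^ m` coefficient of `θ f`
  -- in `Ideal.span B`. Setting `t = 1` recovers `f`.
  let θ : R K →ₐ[K] Polynomial (R K) := aeval fun p =>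
    if p.1 = k then Polynomial.X * Polynomial.C (X p) else Polynomial.C (X p)
  have heval (g : R K) : Polynomial.eval 1 (θ g) = g := by
    have : ((Polynomial.aeval (1 : R K)).restrictScalars K).comp θ = AlgHom.id K _ := by
      ext ⟨i, j⟩
      by_cases hi : i = k <;> simp [θ, hi]
    simpa [Polynomial.aeval_def, Polynomial.eval₂_eq_eval_map] using DFunLike.congr_fun this g
  have hθB (b) (hb : b ∈ B) : θ b = Polynomial.C b := by
    obtain ⟨i, hi, g, rfl⟩ := hB b hb
    have : θ.comp (rename (Prod.mk i)) =
        ((Algebra.ofId (R K) (Polynomial (R K))).restrictScalars K).comp (rename (Prod.mk i)) := by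
      ext j
      simp [θ, hi, Algebra.ofId_apply]
    exact DFunLike.congr_fun this g
  have hθu : Polynomial.X ∣ θ (rename (Prod.mk k) u) := by
    rw [Polynomial.X_dvd_iff, Polynomial.coeff_zero_eq_eval_zero]
    have : (((Polynomial.aeval (0 : R K)).restrictScalars K).comp θ).comp (rename (Prod.mk k)) =
        aeval fun _ => 0 := by
      ext j
      simp [θ]
    have h := DFunLike.congr_fun this u
    rw [aeval_zero', hu] at h
    simpa [Polynomial.aeval_def, Polynomial.eval₂_eq_eval_map] using h
  have hmem : θ f ∈ Ideal.map Polynomial.C (Ideal.span B) := by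
    rw [Ideal.mem_map_C_iff]
    intro m
    obtain ⟨x, hx, y, hy, hxy⟩ := Submodule.mem_sup.1 (hf (m + 1))
    obtain ⟨z, rfl⟩ := Ideal.mem_span_singleton.1 hy
    have hx' : θ x ∈ Ideal.map Polynomial.C (Ideal.span B) := by
      have hle : Ideal.span B ≤ Ideal.comap θ (Ideal.map Polynomial.C (Ideal.span B)) := by
        refine Ideal.span_le.2 fun b hb => ?_
        rw [SetLike.mem_coe, Ideal.mem_comap, hθB b hb]
        exact Ideal.mem_map_of_mem _ (Ideal.subset_span hb)
      exact hle hx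
    have hy' : (θ (rename (Prod.mk k) u ^ (m + 1) * z)).coeff m = 0 := by
      have : Polynomial.X ^ (m + 1) ∣ θ (rename (Prod.mk k) u ^ (m + 1) * z) := by
        rw [map_mul, map_pow]
        exact (pow_dvd_pow_of_dvd hθu _).mul_right _
      exact Polynomial.X_pow_dvd_iff.1 this m (Nat.lt_succ_self m)
    rw [← hxy, map_add, Polynomial.coeff_add, hy', add_zero]
    exact Ideal.mem_map_C_iff.1 hx' m
  rw [← heval f, Polynomial.eval_eq_sum]
  exact Submodule.sum_mem _ fun n _ => Ideal.mul_mem_right _ _ (Ideal.mem_map_C_iff.1 hmem n)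

/-- If `f` vanishes on the lines, it vanishes on `Y`, so `f = x + F k * f'` with `x` in the ideal of
the other two forms. Then `F k * f'` vanishes on the lines, and so does `f'` because `F k` is a
nonzerodivisor there. Iterating puts `f` in that ideal modulo every power of `F k`, and the ideal is
closed for this topology. -/
lemma vanishingIdeal_thickening_eq [Infinite K] {Y : Set (Point K)}
    {g : Fin 3 → MvPolynomial (Fin 2) K} (hg0 : ∀ i, g i ≠ 0)
    (hgc : ∀ i, constantCoeff (g i) = 0)
    (hY : vanishingIdeal Y = Ideal.span (Set.range fun i => rename (Prod.mk i) (g i)))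
    (k : Fin 3) :
    vanishingIdeal (thickening Y k) =
      Ideal.span ((fun i => rename (Prod.mk i) (g i)) '' {i | i ≠ k}) := by
  set F : Fin 3 → R K := fun i => rename (Prod.mk i) (g i)
  have hle : Ideal.span (F '' {i | i ≠ k}) ≤ vanishingIdeal (thickening Y k) := by
    refine Ideal.span_le.2 ?_
    rintro _ ⟨i, hi, rfl⟩ Q ⟨P, hP, hPQ⟩
    have hFi : F i ∈ vanishingIdeal Y := by
      rw [hY]
      exact Ideal.subset_span ⟨i, rfl⟩
    exact vanishesAt_rename_of_eq (hPQ i hi) (hFi P hP)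
  refine le_antisymm (fun f hf => ?_) hle
  have hstep (f) (hf : f ∈ vanishingIdeal (thickening Y k)) :
      ∃ f' ∈ vanishingIdeal (thickening Y k), f - F k * f' ∈ Ideal.span (F '' {i | i ≠ k}) := by
    have hfY : f ∈ vanishingIdeal Y := fun P hP => hf P (subset_thickening Y k hP)
    have hrange : Set.range F = F '' {i | i ≠ k} ∪ {F k} := by
      rw [← Set.image_singleton, ← Set.image_union, ← Set.image_univ]
      congr 1
      ext i
      simp [em]
    rw [hY, hrange, Ideal.span_union] at hfY
    obtain ⟨x, hx, y, hy, rfl⟩ := Submodule.mem_sup.1 hfY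
    obtain ⟨f', rfl⟩ := Ideal.mem_span_singleton.1 hy
    refine ⟨f', regularMod_vanishingIdeal_thickening Y k (hg0 k) f' ?_, by simpa using hx⟩
    simpa using sub_mem hf (hle hx)
  refine mem_span_of_forall_mem_sup_pow k (hgc k) ?_ fun n => ?_
  · rintro _ ⟨i, hi, rfl⟩
    exact ⟨i, hi, g i, rfl⟩
  · change f ∈ _ ⊔ Ideal.span {F k ^ n}
    induction n generalizing f with
    | zero => simp
    | succ n ih =>
      obtain ⟨f', hf', hff'⟩ := hstep f hf
      obtain ⟨x, hx, y, hy, hxy⟩ := Submodule.mem_sup.1 (ih f' hf')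
      obtain ⟨z, rfl⟩ := Ideal.mem_span_singleton.1 hy
      refine Submodule.mem_sup.2 ⟨(f - F k * f') + F k * x,
        add_mem hff' (Ideal.mul_mem_left _ _ hx), F k ^ (n + 1) * z,
        Ideal.mul_mem_right _ _ (Ideal.mem_span_singleton_self _), ?_⟩
      rw [← hxy]
      ring

end Geometry

/-! ### The ideal of the grid, its depth and its resolution -/

section Main

open MvPolynomial

variable {K : Type*} [Field K]

/-- Every nonzero form in two variables is coprime to some linear form. -/
lemma exists_isRelPrime [Infinite K] {g : MvPolynomial (Fin 2) K} (hg0 : g ≠ 0)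
    (hgc : constantCoeff g = 0) :
    ∃ l : MvPolynomial (Fin 2) K, l ≠ 0 ∧ constantCoeff l = 0 ∧ IsRelPrime l g := by
  obtain ⟨w, hw⟩ : ∃ w, eval w g ≠ 0 := by
    by_contra! h
    exact hg0 (funext fun w => by simpa using h w)
  have hw0 : w 0 ≠ 0 ∨ w 1 ≠ 0 := by
    by_contra! h
    refine hw ?_
    have : w = 0 := by
      ext j
      fin_cases j
      · exact h.1
      · exact h.2
    rw [this, eval_zero, hgc]
  -- The linear form vanishing at `w`. It is irreducible and cannot divide `g`, since `g` does not
  -- vanish at `w`.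
  let l : MvPolynomial (Fin 2) K := C (w 1) * X 0 - C (w 0) * X 1
  have hc0 : coeff (Finsupp.single 0 1) l = w 1 := by
    simp [l, coeff_C_mul, coeff_X, Finsupp.single_left_inj]
  have hc1 : coeff (Finsupp.single 1 1) l = - w 0 := by
    simp [l, coeff_C_mul, coeff_X, Finsupp.single_left_inj]
  have hl0 : l ≠ 0 := fun h => by
    rw [h] at hc0 hc1
    rcases hw0 with h' | h'
    · exact h' (by simpa using hc1.symm)
    · exact h' (by simpa using hc0.symm)
  have hhom : l.IsHomogeneous 1 :=
    ((isHomogeneous_X K (0 : Fin 2)).C_mul _).sub ((isHomogeneous_X K (1 : Fin 2)).C_mul _)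
  refine ⟨l, hl0, by simp [l], ?_⟩
  have hirr : Irreducible l := by
    refine irreducible_of_totalDegree_eq_one (hhom.totalDegree hl0) fun x hx => ?_
    refine isUnit_iff_ne_zero.2 fun hx0 => hl0 ?_
    ext d
    simpa [hx0] using hx d
  refine hirr.isRelPrime_iff_not_dvd.2 ?_
  rintro ⟨q, rfl⟩
  refine hw ?_
  rw [map_mul]
  simp [l, mul_comm]

lemma PermutablyRegular.comp {A ι κ : Type*} [CommRing A] {e : ι → A} (he : PermutablyRegular e)
    {s : κ → ι} (hs : Function.Injective s) : PermutablyRegular (e ∘ s) := by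
  intro S p hp
  rw [Set.image_comp]
  exact he _ _ fun ⟨q, hq, hqp⟩ => hp (hs hqp ▸ hq)

lemma mem_irrelevantIdeal_iff {f : R K} : f ∈ irrelevantIdeal K ↔ constantCoeff f = 0 := by
  rw [irrelevantIdeal, ← Set.image_univ, mem_ideal_span_X_image, constantCoeff_eq,
    ← notMem_support_iff]
  constructor
  · intro h h0
    obtain ⟨i, -, hi⟩ := h 0 h0
    exact hi rfl
  · intro h m hm
    by_contra! hc
    have : m = 0 := Finsupp.ext fun i => hc i trivial
    exact h (this ▸ hm)

lemma irrelevantIdeal_ne_top : irrelevantIdeal K ≠ ⊤ := by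
  rw [Ne, Ideal.eq_top_iff_one, mem_irrelevantIdeal_iff]
  simp

/-- The forms defining a complete intersection of points, written in their own variables. -/
lemma IsCompleteIntersectionOfPoints.exists_forms {Y : Set (Point K)} {a : Fin 3 → ℕ}
    (hY : IsCompleteIntersectionOfPoints Y a) :
    ∃ g : Fin 3 → MvPolynomial (Fin 2) K, (∀ i, g i ≠ 0) ∧ (∀ i, constantCoeff (g i) = 0) ∧
      (∀ i, IsTrihomogeneous (rename (Prod.mk i) (g i)) (Pi.single i (a i : ℤ))) ∧
      vanishingIdeal Y = Ideal.span (Set.range fun i => rename (Prod.mk i) (g i)) := by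
  obtain ⟨F, hhom, hreg, hI⟩ := hY
  choose g hg using fun i => (hhom i).exists_rename_eq
  have hrange : ({F 0, F 1, F 2} : Set (R K)) = Set.range F := by
    ext x
    simp [Fin.exists_fin_succ, eq_comm]
  have htop : Ideal.span (Set.range F) ≠ ⊤ := by
    intro h
    apply hreg.top_ne_smul
    rw [← hrange] at h
    have : Ideal.ofList [F 0, F 1, F 2] = ⊤ := by
      rw [← h, Ideal.ofList]
      congr 1
      ext x
      simp
    rw [this]
    simp
  have hF0 (i) : F i ≠ 0 := by
    intro h0
    have hr := (isWeaklyRegular_self_iff _).1 hreg.toIsWeaklyRegular i (by simp)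
    have hFi : [F 0, F 1, F 2][(i : ℕ)]'(by simp) = F i := by
      fin_cases i <;> rfl
    rw [hFi] at hr
    -- If `F i = 0`, regularity of `F i` puts `1` in the ideal of the preceding forms, contradicting
    -- properness.
    have h1 := hr 1 (by simp [h0])
    refine htop ((Ideal.eq_top_iff_one _).2 (Ideal.span_mono ?_ h1))
    intro x hx
    have := List.mem_of_mem_take hx
    rw [← hrange]
    simpa using this
  have hFc (i) : constantCoeff (F i) = 0 := by
    by_contra hc
    -- A nonzero constant term forces degree zero, so `F i` would be a unit, again contradicting
    -- properness.
    have hdeg : (Pi.single i (a i : ℤ) : Fin 3 → ℤ) = 0 := by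
      rw [← hhom i hc, map_zero]
    have hconst : F i = C (constantCoeff (F i)) := by
      ext d
      rw [coeff_C]
      split_ifs with hd
      · rw [← hd, constantCoeff_eq]
      · by_contra hcd
        have := hhom i hcd
        rw [hdeg] at this
        refine hd (Finsupp.ext fun ⟨m, j⟩ => ?_)
        have hm := congrFun this m
        rw [weight_apply_eq, Pi.zero_apply] at hm
        fin_cases j <;> simp <;> omega
    refine htop (Ideal.eq_top_of_isUnit_mem _ (Ideal.subset_span ⟨i, rfl⟩) ?_)
    rw [hconst]
    exact (isUnit_iff_ne_zero.2 hc).map C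
  have hgF : (fun i => rename (Prod.mk i) (g i)) = F := by
    ext1 i
    exact hg i
  refine ⟨g, fun i h => hF0 i (by rw [← hg i, h, map_zero]), fun i => ?_, fun i => ?_, ?_⟩
  · rw [← hFc i, ← hg i, constantCoeff_rename]
  · rw [hg i]
    exact hhom i
  · rw [hgF, ← hrange]
    exact hI

lemma vanishingIdeal_gridVariety_eq [Infinite K] {Y : Set (Point K)}
    {g : Fin 3 → MvPolynomial (Fin 2) K} (hg0 : ∀ i, g i ≠ 0)
    (hgc : ∀ i, constantCoeff (g i) = 0)
    (hY : vanishingIdeal Y = Ideal.span (Set.range fun i => rename (Prod.mk i) (g i)))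
    (hreg : PermutablyRegular fun i => rename (Prod.mk i) (g i)) :
    vanishingIdeal (gridVariety Y) = pairIdeal fun i => rename (Prod.mk i) (g i) := by
  ext f
  rw [mem_vanishingIdeal_gridVariety]
  simp only [vanishingIdeal_thickening_eq hg0 hgc hY]
  set F : Fin 3 → R K := fun i => rename (Prod.mk i) (g i)
  have h0 : F '' {i | i ≠ 0} = {F 1, F 2} := by
    rw [← Set.image_pair]; congr 1; ext i; fin_cases i <;> simp
  have h1 : F '' {i | i ≠ 1} = {F 0, F 2} := by
    rw [← Set.image_pair]; congr 1; ext i; fin_cases i <;> simp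
  have h2 : F '' {i | i ≠ 2} = {F 0, F 1} := by
    rw [← Set.image_pair]; congr 1; ext i; fin_cases i <;> simp
  have hsup {i j k : Fin 3} (hk : k ≠ i ∧ k ≠ j) :
      RegularMod (⊥ ⊔ Ideal.span {F i, F j}) (F k) := by
    simpa using hreg.sup_span_pair ∅ (i := i) (j := j) (k := k) (by simpa using hk)
  rw [Fin.forall_fin_succ, Fin.forall_fin_succ, Fin.forall_fin_one]
  change f ∈ Ideal.span (F '' {i | i ≠ 0}) ∧ f ∈ Ideal.span (F '' {i | i ≠ 1}) ∧
    f ∈ Ideal.span (F '' {i | i ≠ 2}) ↔ _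
  rw [h0, h1, h2]
  constructor
  · rintro ⟨m0, m1, m2⟩
    have := mem_sup_pairIdeal_of_mem (T := ⊥) (F := F) (f := f) (hsup (by simp)) (hsup (by simp))
      (by simpa using m2) (by simpa using m1) (by simpa using m0)
    simpa using this
  · intro h
    obtain ⟨l1, l2, l3⟩ := pairIdeal_le F
    exact ⟨l3 h, l2 h, l1 h⟩

/-- A squeeze: 4 ≤ depth by the sequence built from the `l i` and the sum of the forms, depth ≤
dimension in general, and dimension ≤ 6 - 2 by the codimension bound. -/
lemma depth_quotient_pairIdeal_eq {g : Fin 3 → MvPolynomial (Fin 2) K}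
    (hgc : ∀ i, constantCoeff (g i) = 0) {l : Fin 3 → MvPolynomial (Fin 2) K}
    (hlc : ∀ i, constantCoeff (l i) = 0)
    (hreg : PermutablyRegular fun p : Fin 3 × Fin 2 =>
      (rename (Prod.mk p.1) (![l p.1, g p.1] p.2) : R K)) :
    ((depth (irrelevantIdeal K) (R K ⧸ pairIdeal fun i => rename (Prod.mk i) (g i)) : ℕ∞) :
      WithBot ℕ∞) = ringKrullDim (R K ⧸ pairIdeal fun i => (rename (Prod.mk i) (g i) : R K)) := by
  set F : Fin 3 → R K := fun i => rename (Prod.mk i) (g i)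
  have hF : PermutablyRegular F := hreg.comp (s := fun i => (i, 1)) fun i j h => by simpa using h
  have hFm (i) : F i ∈ irrelevantIdeal K := by
    rw [mem_irrelevantIdeal_iff, constantCoeff_rename, hgc]
  have hlm (i) : rename (Prod.mk i) (l i) ∈ irrelevantIdeal K := by
    rw [mem_irrelevantIdeal_iff, constantCoeff_rename, hlc]
  have hle : pairIdeal F ≤ irrelevantIdeal K := by
    refine (pairIdeal_le F).1.trans (Ideal.span_le.2 ?_)
    rintro _ (rfl | rfl) <;> exact hFm _
  have hne : pairIdeal F ≠ ⊤ := fun h => irrelevantIdeal_ne_top (top_le_iff.1 (h ▸ hle))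
  refine le_antisymm (depth_quotient_le_ringKrullDim _ _ hne) ?_
  have hdepth : ((4 : ℕ) : ℕ∞) ≤ depth (irrelevantIdeal K) (R K ⧸ pairIdeal F) := by
    refine length_le_depth_quotient hle irrelevantIdeal_ne_top ?_
      hreg.isWeaklyRegular_quotient_pairIdeal
    intro r hr
    simp only [List.mem_cons, List.not_mem_nil, or_false] at hr
    rcases hr with rfl | rfl | rfl | rfl
    · exact hlm 0
    · exact hlm 1
    · exact hlm 2
    · exact add_mem (add_mem (hFm 0) (hFm 1)) (hFm 2)
  have hdim := hF.ringKrullDim_quotient_pairIdeal_add_two_le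
  rw [MvPolynomial.ringKrullDim_of_isNoetherianRing, ringKrullDim_eq_zero_of_field] at hdim
  refine le_trans ?_ (WithBot.coe_le_coe.2 hdepth)
  have : Nontrivial (R K ⧸ pairIdeal F) := Ideal.Quotient.nontrivial_iff.2 hne
  obtain ⟨n, hn⟩ := WithBot.ne_bot_iff_exists.1 fun h : ringKrullDim (R K ⧸ pairIdeal F) = ⊥ => by
    simpa [h] using ringKrullDim_nonneg_of_nontrivial (R := R K ⧸ pairIdeal F)
  rw [← hn] at hdim ⊢
  have h6 : n + 2 ≤ 6 := by
    rw [← WithBot.coe_le_coe]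
    simpa using hdim
  rw [WithBot.coe_le_coe]
  have h4 : n + 2 ≤ (4 : ℕ) + 2 := by
    refine h6.trans_eq ?_
    norm_num
  exact (ENat.add_le_add_iff_right (by simp)).1 h4

lemma irrelevantIdeal_smul_top_of_forall_mem {κ : Type*} [Finite κ] {v : κ → R K}
    (hv : ∀ k, v k ∈ irrelevantIdeal K) :
    v ∈ irrelevantIdeal K • (⊤ : Submodule (R K) (κ → R K)) := by
  classical
  have := Fintype.ofFinite κ
  rw [pi_eq_sum_univ' v]
  exact Submodule.sum_mem _ fun k _ => Submodule.smul_mem_smul (hv k) trivial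

lemma exists_isMinimalFreeResolution_pairIdeal {F : Fin 3 → R K} {I : Ideal (R K)}
    (hI : I = pairIdeal F) {a b c : ℕ}
    (hdeg : ∀ i, IsTrihomogeneous (F i) (Pi.single i (![a, b, c] i : ℤ)))
    (hFm : ∀ i, F i ∈ irrelevantIdeal K) (hreg : PermutablyRegular F) :
    ∃ (φ : (Fin 2 → R K) →ₗ[R K] (Fin 3 → R K)) (ε : (Fin 3 → R K) →ₗ[R K] I),
      IsMinimalFreeResolution I ![![(a : ℤ), b, c], ![(a : ℤ), b, c]]
        ![![(a : ℤ), b, 0], ![(a : ℤ), 0, c], ![0, (b : ℤ), c]] φ ε := by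
  subst hI
  have hd {i j : Fin 3} (hij : i ≠ j) {f : R K} (h : F i ∣ F j * f) : F i ∣ f :=
    hreg.dvd_of_dvd_mul hij h
  have hF0 (i : Fin 3) : F i ≠ 0 := fun h => one_ne_zero (hreg.eq_zero_of_mul (i := i) (f := 1)
    (by rw [h, zero_mul]))
  -- The columns are the syzygies between consecutive products: `F 2 * (F 0 * F 1) = F 1 * (F 0 * F
  -- 2)` and `F 1 * (F 0 * F 2) = F 0 * (F 1 * F 2)`.
  let φ : (Fin 2 → R K) →ₗ[R K] (Fin 3 → R K) :=
    Matrix.mulVecLin !![F 2, 0; -F 1, F 1; 0, -F 0]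
  have hφ (v) : φ v = ![F 2 * v 0, F 1 * (v 1 - v 0), -(F 0 * v 1)] := by
    ext1 i
    fin_cases i <;> simp [φ, Matrix.mulVec, dotProduct, Fin.sum_univ_two]
    ring
  let ε₀ : (Fin 3 → R K) →ₗ[R K] R K :=
    Fintype.linearCombination (R K) ![F 0 * F 1, F 0 * F 2, F 1 * F 2]
  have hε₀ (v) : ε₀ v = v 0 * (F 0 * F 1) + v 1 * (F 0 * F 2) + v 2 * (F 1 * F 2) := by
    simp [ε₀, Fintype.linearCombination_apply, Fin.sum_univ_three]
  have hmem (v) : ε₀ v ∈ pairIdeal F := by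
    rw [hε₀]
    refine add_mem (add_mem ?_ ?_) ?_ <;>
    exact Ideal.mul_mem_left _ _ (Ideal.subset_span (by simp))
  let ε : (Fin 3 → R K) →ₗ[R K] pairIdeal F := ε₀.codRestrict (pairIdeal F) hmem
  have hε (v) : (ε v : R K) = v 0 * (F 0 * F 1) + v 1 * (F 0 * F 2) + v 2 * (F 1 * F 2) := hε₀ v
  have mulT {f g : R K} {m n k : Fin 3 → ℤ} (hf : IsTrihomogeneous f m)
      (hg : IsTrihomogeneous g n) (h : m + n = k) : IsTrihomogeneous (f * g) k :=
    h ▸ IsWeightedHomogeneous.mul hf hg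
  refine ⟨φ, ε, ⟨?_, ?_, ?_, ?_, ?_, ?_⟩⟩
  · intro n v hv i
    have h0 := hv 0
    have h1 := hv 1
    rw [hφ]
    fin_cases i
    · refine mulT (hdeg 2) h0 ?_
      ext j; fin_cases j <;> simp <;> rfl
    · refine mulT (hdeg 1) (IsWeightedHomogeneous.sub h1 h0) ?_
      ext j; fin_cases j <;> simp <;> rfl
    · refine IsWeightedHomogeneous.neg (mulT (hdeg 0) h1 ?_)
      ext j; fin_cases j <;> simp <;> rfl
  · intro n v hv
    rw [hε]
    refine IsWeightedHomogeneous.add (IsWeightedHomogeneous.add ?_ ?_) ?_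
    · refine mulT (hv 0) (mulT (hdeg 0) (hdeg 1) rfl) ?_
      ext j; fin_cases j <;> simp <;> rfl
    · refine mulT (hv 1) (mulT (hdeg 0) (hdeg 2) rfl) ?_
      ext j; fin_cases j <;> simp <;> rfl
    · refine mulT (hv 2) (mulT (hdeg 1) (hdeg 2) rfl) ?_
      ext j; fin_cases j <;> simp <;> rfl
  · rw [injective_iff_map_eq_zero]
    intro v hv
    rw [hφ] at hv
    have h0 : F 2 * v 0 = 0 := congrFun hv 0
    have h1 : -(F 0 * v 1) = 0 := congrFun hv 2
    ext1 i
    fin_cases i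
    · simpa [hF0] using h0
    · simpa [hF0] using h1
  · intro v
    constructor
    · intro hv
      have hv : v 0 * (F 0 * F 1) + v 1 * (F 0 * F 2) + v 2 * (F 1 * F 2) = 0 := by
        rw [← hε, hv]
        rfl
      -- Modulo `F 2` the relation reads `v 0 * F 0 * F 1 = 0`, and modulo `F 0` it reads `v 2 * F 1
      -- * F 2 = 0`. The two quotients `s` and `t` determine the preimage, and `v 1` is then forced
      -- by cancelling `F 0 * F 2`.
      obtain ⟨s, hs⟩ : F 2 ∣ v 0 := by
        refine hd (j := 1) (by simp) (hd (j := 0) (by simp) ⟨-(v 1 * F 0 + v 2 * F 1), ?_⟩)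
        linear_combination hv
      obtain ⟨t, ht⟩ : F 0 ∣ v 2 := by
        refine hd (j := 1) (by simp) (hd (j := 2) (by simp) ⟨-(v 0 * F 1 + v 1 * F 2), ?_⟩)
        linear_combination hv
      refine ⟨![s, -t], ?_⟩
      have h1 : v 1 = F 1 * (-t - s) := by
        refine mul_left_cancel₀ (mul_ne_zero (hF0 0) (hF0 2)) ?_
        linear_combination hv - F 0 * F 1 * hs - F 1 * F 2 * ht
      rw [hφ]
      ext1 i
      fin_cases i
      · simp [hs]
      · simp [h1]
      · simp [ht]
    · rintro ⟨w, rfl⟩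
      refine Subtype.ext ?_
      rw [hε, hφ]
      simp
      ring
  · rintro ⟨f, hf⟩
    obtain ⟨p, q, r, h⟩ := Submodule.mem_span_triple.1 hf
    refine ⟨![p, q, r], Subtype.ext ?_⟩
    rw [hε]
    simpa using h
  · rintro _ ⟨v, rfl⟩
    refine irrelevantIdeal_smul_top_of_forall_mem fun i => ?_
    rw [hφ]
    fin_cases i
    · exact Ideal.mul_mem_right _ _ (hFm 2)
    · exact Ideal.mul_mem_right _ _ (hFm 1)
    · exact neg_mem (Ideal.mul_mem_right _ _ (hFm 0))

end Main

end TriProj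

theorem mainTheorem3 {K : Type*} [Field K] [IsAlgClosed K] [CharZero K]
    (C : Set (TriProj.Point K)) (hfin : C.Finite) (a b c : ℕ)
    (hC : TriProj.IsCompleteIntersectionOfPoints C ![a, b, c]) :
    TriProj.IsACM (TriProj.gridVariety C) ∧
    ∃ (φ : (Fin 2 → TriProj.R K) →ₗ[TriProj.R K] (Fin 3 → TriProj.R K))
      (ε : (Fin 3 → TriProj.R K) →ₗ[TriProj.R K]
        TriProj.vanishingIdeal (TriProj.gridVariety C)),
      TriProj.IsMinimalFreeResolution (TriProj.vanishingIdeal (TriProj.gridVariety C))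
        ![![(a : ℤ), b, c], ![(a : ℤ), b, c]]
        ![![(a : ℤ), b, 0], ![(a : ℤ), 0, c], ![0, (b : ℤ), c]] φ ε := by
  have : Infinite K := IsAlgClosed.instInfinite
  obtain ⟨g, hg0, hgc, hdeg, hY⟩ := hC.exists_forms
  choose l hl0 hlc hrel using fun i => TriProj.exists_isRelPrime (hg0 i) (hgc i)
  -- Second index 0 is the auxiliary linear form and 1 the given form, so the forms alone are the
  -- subfamily with second index 1.
  have hreg := TriProj.permutablyRegular_rename (fun i => ![l i, g i])
    (fun i j => by fin_cases j <;> simp [hl0, hg0]) (fun i => by simpa using hrel i)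
  have hF : TriProj.PermutablyRegular fun i =>
      (MvPolynomial.rename (Prod.mk i) (g i) : TriProj.R K) :=
    hreg.comp (s := fun i => (i, 1)) fun i j h => by simpa using h
  have hI := TriProj.vanishingIdeal_gridVariety_eq hg0 hgc hY hF
  refine ⟨?_, TriProj.exists_isMinimalFreeResolution_pairIdeal hI hdeg (fun i => ?_) hF⟩
  · rw [TriProj.IsACM, hI]
    exact TriProj.depth_quotient_pairIdeal_eq hgc hlc hreg
  · rw [TriProj.mem_irrelevantIdeal_iff, MvPolynomial.constantCoeff_rename, hgc]
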